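/- A two-qubit X state in standard form (every X state can be brought to it by local unitaries) is \[ \rho^{AB}=\begin{pmatrix} a&0&0&u\\ 0&b&v&0\\ 0&v&c&0\\ u&0&0&d\end{pmatrix},\qquad a,b,c,d,u,v\ge 0,\quad a+b+c+d=1,\quad u^2\le ad,\quad v^2\le bc . \] For a measurement on $A$ given by a POVM $M=\{M_i\}$ (finitely many $M_i\ge 0$ with $\sum_i M_i=\mathbb 1$), put $p_i=\operatorname{Tr}[(M_i\otimes\mathbb 1)\rho^{AB}]$, $\rho^{B|M_i}=\operatorname{Tr}_A[(M_i\otimes\mathbb 1)\rho^{AB}]/p_i$ and $S(\rho^B|M)=\sum_i p_iS(\rho^{B|M_i})$, where $S$ is the von Neumann entropy in bits; $M$ is called optimal if it minimizes $S(\rho^B|M)$ among all POVMs. The steering ellipsoid $\mathfrak E$ of $\rho^{AB}$ is the set of the Bloch vectors of all states $\rho^{B|M_i}$ (with $p_i>0$) obtained from POVMs on $A$. Let \[ \ell_1=\frac{u+v}{\sqrt{(a+b)(c+d)}},\quad \ell_3=\frac{|ad-bc|}{(a+b)(c+d)},\quad z_0=\frac{ac-bd}{(a+b)(c+d)},\quad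 z_H=z_0-\ell_3,\quad z_G=z_0+\ell_3, \] \[ h(x)=-\tfrac{1+x}{2}\log_2\tfrac{1+x}{2}-\tfrac{1-x}{2}\log_2\tfrac{1-x}{2},\qquad r(z)=\Big[z^2+\ell_1^2\Big(1-\frac{(z-z_0)^2}{\ell_3^2}\Big)\Big]^{1/2}, \] and let $\overline S_{\leftrightarrow}(z)=h(r(z))$ for $z\in[z_H,z_G]$ be the horizontal average entropy. (i) If $\overline S_{\leftrightarrow}$ is convex on $[z_H,z_G]$, then for every X state in standard form whose steering ellipsoid is $\mathfrak E$, the horizontal decomposition of $\rho^B$, induced by the measurement of $\sigma_x$ on $A$, is optimal. This includes the degenerate case $ad=bc$, in which $[z_H,z_G]$ is regarded as a single point and the convexity hypothesis as satisfied. (ii) If $ad\neq bc$ and $\overline S_{\leftrightarrow}$ is concave on $[z_H,z_G]$, then for every X state in standard form whose steering ellipsoid is $\mathfrak E$, the vertical decomposition of $\rho^B$, induced by the measurement of $\sigma_z$ on $A$, is optimal. -/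

import Mathlib

open Matrix
open scoped Kronecker ComplexOrder

namespace XDiscord

noncomputable section

/-- Operators on a single qubit, in the computational basis. -/
abbrev Op := Matrix (Fin 2) (Fin 2) ℂ

/-- Operators on the two-qubit system `AB`; the first index belongs to `A`. -/
abbrev Op2 := Matrix (Fin 2 × Fin 2) (Fin 2 × Fin 2) ℂ

/-- The Pauli matrices. -/
def pauliX : Op := !![0, 1; 1, 0]

def pauliY : Op := !![0, -Complex.I; Complex.I, 0]

def pauliZ : Op := !![1, 0; 0, -1]

/-- Partial trace over the first qubit. -/
def traceA (R : Op2) : Op := fun j j' => ∑ i, R (i, j) (i, j')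

/-- A POVM with `n` outcomes on one qubit. -/
def IsPOVM {n : ℕ} (M : Fin n → Op) : Prop :=
  (∀ i, (M i).PosSemidef) ∧ ∑ i, M i = 1

/-- Probability `Tr[(M ⊗ 1) ρ]` of the outcome of a measurement on `A` with operation element `M`. -/
def outcomeProb (ρ : Op2) (M : Op) : ℝ := (((M ⊗ₖ (1 : Op)) * ρ).trace).re

/-- State `Tr_A[(M ⊗ 1) ρ] / p` of `B` after the outcome with operation element `M`. -/
def condState (ρ : Op2) (M : Op) : Op :=
  ((outcomeProb ρ M : ℂ)⁻¹) • traceA ((M ⊗ₖ (1 : Op)) * ρ)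

open Classical in
/-- Von Neumann entropy in bits, `-∑ λ log₂ λ` over the eigenvalues `λ` of a Hermitian matrix. -/
def vnEntropy (σ : Op) : ℝ :=
  if h : σ.IsHermitian then
    -∑ i, h.eigenvalues i * Real.logb 2 (h.eigenvalues i)
  else 0

/-- Conditional entropy `S(ρ^B | M) = ∑ pᵢ S(ρ^{B|Mᵢ})` for a measurement `M` on `A`. -/
def condEntropy {n : ℕ} (ρ : Op2) (M : Fin n → Op) : ℝ :=
  ∑ i, outcomeProb ρ (M i) * vnEntropy (condState ρ (M i))

/-- The POVM `M` on `A` attains the minimum of the conditional entropy among all POVMs on `A`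
(with any finite number of outcomes). -/
def IsOptimalMeasurement {n : ℕ} (ρ : Op2) (M : Fin n → Op) : Prop :=
  IsPOVM M ∧ ∀ (m : ℕ) (N : Fin m → Op), IsPOVM N → condEntropy ρ M ≤ condEntropy ρ N

/-- The von Neumann measurement of an observable `σ` with `σ ^ 2 = 1`: its two spectral
projections `(1 ± σ) / 2`. -/
def spinMeasurement (σ : Op) : Fin 2 → Op :=
  ![(1 / 2 : ℂ) • (1 + σ), (1 / 2 : ℂ) • (1 - σ)]

/-- Bloch vector of a one-qubit operator. -/
def blochVector (σ : Op) : Fin 3 → ℝ :=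
  ![((σ * pauliX).trace).re, ((σ * pauliY).trace).re, ((σ * pauliZ).trace).re]

/-- Quantum steering ellipsoid: the region of all Bloch vectors of the states to which `B` can be
steered by an outcome of positive probability of a measurement on `A`. An operator `M` is an element
of some POVM exactly when `0 ≤ M ≤ 1`. -/
def steeringEllipsoid (ρ : Op2) : Set (Fin 3 → ℝ) :=
  {w | ∃ M : Op, M.PosSemidef ∧ (1 - M).PosSemidef ∧ 0 < outcomeProb ρ M ∧
    w = blochVector (condState ρ M)}

/-- Parameters of a two-qubit X state in its standard form (reached by local unitaries). -/
structure XState where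
  a : ℝ
  b : ℝ
  c : ℝ
  d : ℝ
  u : ℝ
  v : ℝ
  a_nonneg : 0 ≤ a
  b_nonneg : 0 ≤ b
  c_nonneg : 0 ≤ c
  d_nonneg : 0 ≤ d
  u_nonneg : 0 ≤ u
  v_nonneg : 0 ≤ v
  trace_one : a + b + c + d = 1
  u_sq_le : u ^ 2 ≤ a * d
  v_sq_le : v ^ 2 ≤ b * c

namespace XState

/-- The density matrix, in the ordered basis `|00⟩, |01⟩, |10⟩, |11⟩`. -/
def rho (X : XState) : Op2 :=
  (!![(X.a : ℂ), 0, 0, X.u;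
      0, X.b, X.v, 0;
      0, X.v, X.c, 0;
      X.u, 0, 0, X.d] : Matrix (Fin 4) (Fin 4) ℂ).submatrix finProdFinEquiv finProdFinEquiv

/-- Semi-axis along `x` of the steering ellipsoid. -/
def l1 (X : XState) : ℝ := (X.u + X.v) / √((X.a + X.b) * (X.c + X.d))

/-- Semi-axis along `z` of the steering ellipsoid. -/
def l3 (X : XState) : ℝ := |X.a * X.d - X.b * X.c| / ((X.a + X.b) * (X.c + X.d))

/-- Height of the center of the steering ellipsoid. -/
def z0 (X : XState) : ℝ := (X.a * X.c - X.b * X.d) / ((X.a + X.b) * (X.c + X.d))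

/-- Height of the lower vertex `H`. -/
def zH (X : XState) : ℝ := X.z0 - X.l3

/-- Height of the upper vertex `G`. -/
def zG (X : XState) : ℝ := X.z0 + X.l3

end XState

/-- Entropy, in bits, of a qubit state whose Bloch vector has length `x`. -/
def h (x : ℝ) : ℝ :=
  -((1 + x) / 2) * Real.logb 2 ((1 + x) / 2) - (1 - x) / 2 * Real.logb 2 ((1 - x) / 2)

namespace XState

/-- Distance from the origin to the points at height `z` of the ellipse cut out of the steering
ellipsoid by the `x`-`z` plane. -/
def r (X : XState) (z : ℝ) : ℝ := √(z ^ 2 + X.l1 ^ 2 * (1 - (z - X.z0) ^ 2 / X.l3 ^ 2))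

/-- The horizontal average entropy. -/
def horizontalEntropy (X : XState) (z : ℝ) : ℝ := h (X.r z)

end XState

/-- For every X state with steering ellipsoid `E`, the horizontal decomposition of `ρ^B`, induced
by measuring `σ_x` on `A`, is optimal. -/
def IsHorizontalType (E : Set (Fin 3 → ℝ)) : Prop :=
  ∀ Y : XState, steeringEllipsoid Y.rho = E →
    IsOptimalMeasurement Y.rho (spinMeasurement pauliX)

/-- For every X state with steering ellipsoid `E`, the vertical decomposition of `ρ^B`, induced
by measuring `σ_z` on `A`, is optimal. -/
def IsVerticalType (E : Set (Fin 3 → ℝ)) : Prop :=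
  ∀ Y : XState, steeringEllipsoid Y.rho = E →
    IsOptimalMeasurement Y.rho (spinMeasurement pauliZ)

end

end XDiscord

/-! An outcome $M$ on $A$ matters mainly through the weight `relHeight` $s=M_{00}(a+b)/p$, as it
puts the Bloch vector of $B$ at height $sz_1+(1-s)z_2$. Positivity of $M$ limits its coherence, so
this vector is no longer than the boundary radius `radius` at that height; since `h` decreases, the
outcome contributes at least $p\,h(\mathrm{radius}(s))$ (`outcomeProb_mul_le`). For every POVM the
mean of $s$ is $a+b$. If $h\circ\mathrm{radius}$ is convex, Jensen gives the bound
$h(\mathrm{radius}(a+b))$, attained by $\sigma_x$, both of whose outcomes have $s=a+b$. If it is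
concave, the chord over $[0,1]$ gives the bound, attained by $\sigma_z$, whose outcomes sit at the
ends. For $ad\ne bc$ height is an invertible affine function of $s$, so the hypotheses on
`horizontalEntropy` transfer. They depend only on the extents of the ellipsoid
(`horizontalEntropy_congr`), hence hold for every state sharing it. For $ad=bc$ convexity in $s$ is
proved outright (`convexOn_h_sqrt_abs`). -/

namespace XDiscord

/-! ### Entropy of a qubit. -/

theorem h_eq_binEntropy (x : ℝ) : h x = Real.binEntropy ((1 + x) / 2) / Real.log 2 := by
  have e : 1 - (1 + x) / 2 = (1 - x) / 2 := by ring
  rw [h, Real.binEntropy_eq_negMulLog_add_negMulLog_one_sub, e]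
  simp only [Real.negMulLog, Real.logb]
  ring

theorem h_neg (x : ℝ) : h (-x) = h x := by
  unfold h
  rw [show 1 - -x = 1 + x by ring, show 1 + -x = 1 - x by ring]
  ring

theorem h_antitoneOn : AntitoneOn h (Set.Icc 0 1) := by
  intro x hx y hy hxy
  rw [h_eq_binEntropy, h_eq_binEntropy]
  have h2 : (0 : ℝ) < Real.log 2 := Real.log_pos one_lt_two
  gcongr
  refine Real.binEntropy_strictAntiOn.antitoneOn ?_ ?_ (by linarith)
  · constructor <;> norm_num <;> linarith [hx.1, hx.2]
  · constructor <;> norm_num <;> linarith [hy.1, hy.2]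

/-- The eigenvalues are $e$ and $1-e$ with product $\det\sigma$, and $1-4e(1-e)=(2e-1)^2$. -/
theorem vnEntropy_eq {σ : Op} (hσ : σ.IsHermitian) (htr : σ.trace = 1) :
    vnEntropy σ = h (√(1 - 4 * σ.det.re)) := by
  have h1 := hσ.trace_eq_sum_eigenvalues
  have h2 := hσ.det_eq_prod_eigenvalues
  rw [htr, Fin.sum_univ_two] at h1
  rw [Fin.prod_univ_two] at h2
  simp only [Complex.coe_algebraMap] at h1 h2
  have h1' : hσ.eigenvalues 0 + hσ.eigenvalues 1 = 1 := by exact_mod_cast h1.symm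
  have h2' : σ.det.re = hσ.eigenvalues 0 * hσ.eigenvalues 1 := by
    rw [h2, ← Complex.ofReal_mul, Complex.ofReal_re]
  rw [vnEntropy, dif_pos hσ, Fin.sum_univ_two, h2']
  set e := hσ.eigenvalues 0
  have he : hσ.eigenvalues 1 = 1 - e := by linarith
  rw [he, show 1 - 4 * (e * (1 - e)) = (2 * e - 1) ^ 2 by ring, Real.sqrt_sq_eq_abs]
  have key : h |2 * e - 1| = h (2 * e - 1) := by
    rcases abs_choice (2 * e - 1) with h | h <;> rw [h]
    exact h_neg _
  rw [key, h, show (1 + (2 * e - 1)) / 2 = e by ring, show (1 - (2 * e - 1)) / 2 = 1 - e by ring]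
  ring

/-! ### Measuring one side of an X state. -/

namespace XState

variable (X : XState)

theorem rho_apply (i j k l : Fin 2) : X.rho (i, j) (k, l) =
    (!![(X.a : ℂ), 0, 0, X.u;
      0, X.b, X.v, 0;
      0, X.v, X.c, 0;
      X.u, 0, 0, X.d] : Matrix (Fin 4) (Fin 4) ℂ) (finProdFinEquiv (i, j))
        (finProdFinEquiv (k, l)) := rfl

theorem traceA_kronecker_mul_rho (M : Op) : traceA ((M ⊗ₖ (1 : Op)) * X.rho) =
    !![M 0 0 * X.a + M 1 1 * X.c, M 1 0 * X.u + M 0 1 * X.v;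
      M 1 0 * X.v + M 0 1 * X.u, M 0 0 * X.b + M 1 1 * X.d] := by
  have e00 : (finProdFinEquiv ((0 : Fin 2), (0 : Fin 2)) : Fin 4) = 0 := rfl
  have e01 : (finProdFinEquiv ((0 : Fin 2), (1 : Fin 2)) : Fin 4) = 1 := rfl
  have e10 : (finProdFinEquiv ((1 : Fin 2), (0 : Fin 2)) : Fin 4) = 2 := rfl
  have e11 : (finProdFinEquiv ((1 : Fin 2), (1 : Fin 2)) : Fin 4) = 3 := rfl
  ext j k
  fin_cases j <;> fin_cases k <;>
    simp [traceA, Matrix.mul_apply, Fintype.sum_prod_type, rho_apply, e00, e01, e10, e11,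
      Matrix.one_apply] <;> ring

theorem trace_eq_traceA (R : Op2) : R.trace = (traceA R).trace := by
  simp only [Matrix.trace, Matrix.diag, traceA, Fintype.sum_prod_type]
  exact Finset.sum_comm

theorem outcomeProb_eq (M : Op) : outcomeProb X.rho M =
    (M 0 0).re * (X.a + X.b) + (M 1 1).re * (X.c + X.d) := by
  rw [outcomeProb, trace_eq_traceA, traceA_kronecker_mul_rho]
  simp [Matrix.trace_fin_two]
  ring

end XState

/-! ### Positive operators and projective measurements. -/

theorem posSemidef_entries {M : Op} (hM : M.PosSemidef) :
    0 ≤ (M 0 0).re ∧ 0 ≤ (M 1 1).re ∧ M 0 0 = ((M 0 0).re : ℂ) ∧ M 1 1 = ((M 1 1).re : ℂ) ∧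
    M 1 0 = star (M 0 1) ∧ Complex.normSq (M 0 1) ≤ (M 0 0).re * (M 1 1).re := by
  have h0 := Complex.nonneg_iff.1 (hM.diag_nonneg (i := 0))
  have h1 := Complex.nonneg_iff.1 (hM.diag_nonneg (i := 1))
  have hd := Complex.nonneg_iff.1 hM.det_nonneg
  have hs : M 1 0 = star (M 0 1) := (hM.1.apply 1 0).symm
  have e0 : M 0 0 = ((M 0 0).re : ℂ) := Complex.ext (by simp) (by simp [← h0.2])
  have e1 : M 1 1 = ((M 1 1).re : ℂ) := Complex.ext (by simp) (by simp [← h1.2])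
  refine ⟨h0.1, h1.1, e0, e1, hs, ?_⟩
  have := hd.1
  rw [Matrix.det_fin_two, hs] at this
  simp [Complex.mul_re, ← h0.2, ← h1.2] at this
  rw [Complex.normSq_apply]
  linarith

theorem posSemidef_of_isHermitian_of_mul_self {M : Op} (h1 : M.IsHermitian) (h2 : M * M = M) :
    M.PosSemidef := by
  have := Matrix.posSemidef_conjTranspose_mul_self M
  rwa [h1.eq, h2] at this

theorem posSemidef_one_sub {M : Op} (h1 : M.IsHermitian) (h2 : M * M = M) :
    (1 - M).PosSemidef := by
  refine posSemidef_of_isHermitian_of_mul_self (Matrix.isHermitian_one.sub h1) ?_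
  simp [sub_mul, mul_sub, h2]

theorem isPOVM_spinMeasurement {σ : Op} (h1 : σ.IsHermitian) (h2 : σ * σ = 1) :
    IsPOVM (spinMeasurement σ) := by
  have a2 : ((1 / 2 : ℂ) • (1 + σ)) * ((1 / 2 : ℂ) • (1 + σ)) = (1 / 2 : ℂ) • (1 + σ) := by
    simp only [smul_mul_smul_comm, add_mul, mul_add, h2, mul_one, one_mul]
    module
  have a1 : ((1 / 2 : ℂ) • (1 + σ)).IsHermitian := by
    refine (Matrix.isHermitian_one.add h1).smul ?_
    simp [IsSelfAdjoint]
  have e : (1 / 2 : ℂ) • (1 - σ) = 1 - (1 / 2 : ℂ) • (1 + σ) := by module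
  constructor
  · intro i
    fin_cases i
    · exact posSemidef_of_isHermitian_of_mul_self a1 a2
    · change ((1 / 2 : ℂ) • (1 - σ)).PosSemidef
      rw [e]
      exact posSemidef_one_sub a1 a2
  · rw [Fin.sum_univ_two]
    simp only [spinMeasurement, Matrix.cons_val_zero, Matrix.cons_val_one]
    module

/-! ### Convexity of the entropy along a horizontal chord. -/

/-- The left side is the first term of the odd power series of the right side, whose terms are all
nonnegative. -/
theorem two_mul_le_log_sub_log {r : ℝ} (h0 : 0 ≤ r) (h1 : r < 1) :
    2 * r ≤ Real.log ((1 + r) / 2) - Real.log ((1 - r) / 2) := by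
  rw [Real.log_div (by linarith) two_ne_zero, Real.log_div (by linarith) two_ne_zero]
  have hs := Real.hasSum_log_sub_log_of_abs_lt_one (x := r) (by rwa [abs_of_nonneg h0])
  have := le_hasSum hs 0 fun j _ => by positivity
  norm_num at this
  linarith

theorem convexOn_binEntropy_sqrt {C l : ℝ} (hC : C ≤ 1) (hl : l ^ 2 ≤ C) :
    ConvexOn ℝ (Set.Icc 0 l) fun x => Real.binEntropy ((1 + √(C - x ^ 2)) / 2) := by
  have key : ∀ x ∈ Set.Ioo 0 l, 0 < C - x ^ 2 ∧ 0 < √(C - x ^ 2) ∧ √(C - x ^ 2) < 1 ∧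
      √(C - x ^ 2) ^ 2 = C - x ^ 2 := by
    intro x hx
    have hp : 0 < C - x ^ 2 := by nlinarith [hx.1, hx.2]
    refine ⟨hp, Real.sqrt_pos.2 hp, ?_, Real.sq_sqrt hp.le⟩
    rw [Real.sqrt_lt' one_pos]
    nlinarith [hx.1, hx.2]
  have hr : ∀ x ∈ Set.Ioo 0 l,
      HasDerivAt (fun y => √(C - y ^ 2)) (-(x / √(C - x ^ 2))) x := by
    intro x hx
    obtain ⟨hp, h0, -, -⟩ := key x hx
    refine (((hasDerivAt_pow 2 x).const_sub C).sqrt hp.ne').congr_deriv ?_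
    simp only [Nat.cast_ofNat, Nat.add_one_sub_one, pow_one]
    field_simp
  refine convexOn_of_hasDerivWithinAt2_nonneg (convex_Icc 0 l)
    (f' := fun x => x * ((Real.log ((1 + √(C - x ^ 2)) / 2) - Real.log ((1 - √(C - x ^ 2)) / 2))
      / (2 * √(C - x ^ 2))))
    (f'' := fun x => 1 * ((Real.log ((1 + √(C - x ^ 2)) / 2) - Real.log ((1 - √(C - x ^ 2)) / 2))
      / (2 * √(C - x ^ 2))) + x * ((((-(x / √(C - x ^ 2)) / 2) / ((1 + √(C - x ^ 2)) / 2) -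
        ((-(-(x / √(C - x ^ 2))) / 2) / ((1 - √(C - x ^ 2)) / 2))) * (2 * √(C - x ^ 2)) -
        (Real.log ((1 + √(C - x ^ 2)) / 2) - Real.log ((1 - √(C - x ^ 2)) / 2)) *
          (2 * -(x / √(C - x ^ 2)))) / (2 * √(C - x ^ 2)) ^ 2))
    ?_ ?_ ?_ ?_
  · exact (Real.binEntropy_continuous.comp (by fun_prop)).continuousOn
  · rw [interior_Icc]
    intro x hx
    obtain ⟨hp, h0, h1, -⟩ := key x hx
    refine HasDerivAt.hasDerivWithinAt ?_
    have hb := Real.hasDerivAt_binEntropy (p := (1 + √(C - x ^ 2)) / 2)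
      (by positivity) (by linarith)
    refine (hb.comp x (((hr x hx).const_add 1).div_const 2)).congr_deriv ?_
    rw [show 1 - (1 + √(C - x ^ 2)) / 2 = (1 - √(C - x ^ 2)) / 2 by ring]
    field_simp
    ring
  · rw [interior_Icc]
    intro x hx
    obtain ⟨hp, h0, h1, -⟩ := key x hx
    refine HasDerivAt.hasDerivWithinAt ?_
    refine (hasDerivAt_id x).mul (HasDerivAt.div (HasDerivAt.sub ?_ ?_) ?_ (by positivity))
    · exact (((hr x hx).const_add 1).div_const 2).log (by positivity)
    · exact (((hr x hx).const_sub 1).div_const 2).log (by linarith)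
    · exact (hr x hx).const_mul 2
  · rw [interior_Icc]
    intro x hx
    obtain ⟨hp, h0, h1, hsq⟩ := key x hx
    have hL := two_mul_le_log_sub_log h0.le h1
    set L := Real.log ((1 + √(C - x ^ 2)) / 2) - Real.log ((1 - √(C - x ^ 2)) / 2)
    set r := √(C - x ^ 2)
    have hr2 : 0 < 1 - r ^ 2 := by nlinarith
    have hr3 : 0 < 1 - r := by linarith
    have : 1 * (L / (2 * r)) + x * (((-(x / r) / 2 / ((1 + r) / 2) -
        -(-(x / r)) / 2 / ((1 - r) / 2)) * (2 * r) - L * (2 * -(x / r))) / (2 * r) ^ 2) =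
        (L * (r ^ 2 + x ^ 2) * (1 - r ^ 2) - 2 * r * x ^ 2) / (2 * r ^ 3 * (1 - r ^ 2)) := by
      rw [show 1 - r ^ 2 = (1 + r) * (1 - r) by ring]
      field_simp
      ring
    rw [this]
    refine div_nonneg ?_ (by positivity)
    have hx2 : x ^ 2 ≤ 1 - r ^ 2 := by linarith
    -- Replacing $L$ by $2r$ turns the numerator of the second derivative into $2r^3(1-r^2-x^2)$,
    -- where $r^2+x^2=C\le1$.
    have h3 : 2 * r * ((r ^ 2 + x ^ 2) * (1 - r ^ 2)) ≤ L * ((r ^ 2 + x ^ 2) * (1 - r ^ 2)) := by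
      gcongr
    have h4 : 0 ≤ 2 * r * (r ^ 2 * (1 - r ^ 2 - x ^ 2)) := by
      have : 0 ≤ 1 - r ^ 2 - x ^ 2 := by linarith
      positivity
    nlinarith

/-- If `l ^ 2 ≤ C ≤ 1`, the entropy of a qubit whose Bloch vector has length `√(C - x ^ 2)` is a
convex function of `x ∈ [0, l]`. -/
theorem convexOn_h_sqrt {C l : ℝ} (hC : C ≤ 1) (hl : l ^ 2 ≤ C) :
    ConvexOn ℝ (Set.Icc 0 l) fun x => h √(C - x ^ 2) := by
  have := (convexOn_binEntropy_sqrt hC hl).smul (inv_nonneg.2 (Real.log_pos one_lt_two).le)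
  simpa only [h_eq_binEntropy, smul_eq_mul, div_eq_inv_mul] using this

theorem monotoneOn_h_sqrt {C l : ℝ} (hC : C ≤ 1) :
    MonotoneOn (fun x => h √(C - x ^ 2)) (Set.Icc 0 l) := by
  intro x hx y hy hxy
  have hsq : x ^ 2 ≤ y ^ 2 := pow_le_pow_left₀ hx.1 hxy 2
  have hle : ∀ t : ℝ, √(C - t ^ 2) ∈ Set.Icc (0 : ℝ) 1 := fun t =>
    ⟨Real.sqrt_nonneg _, Real.sqrt_le_one.2 (by nlinarith [sq_nonneg t])⟩
  exact h_antitoneOn (hle y) (hle x) (Real.sqrt_le_sqrt (by linarith))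

/-- A convex increasing function composed with the convex map $s\mapsto l|2s-1|$. -/
theorem convexOn_h_sqrt_abs {C l : ℝ} (hC : C ≤ 1) (hl0 : 0 ≤ l) (hl : l ^ 2 ≤ C) :
    ConvexOn ℝ (Set.Icc 0 1) fun s => h √(C - (l * (2 * s - 1)) ^ 2) := by
  have hmem : ∀ s ∈ Set.Icc (0 : ℝ) 1, l * |2 * s - 1| ∈ Set.Icc 0 l := by
    intro s hs
    refine ⟨by positivity, mul_le_of_le_one_right hl0 ?_⟩
    rw [abs_le]
    constructor <;> linarith [hs.1, hs.2]
  have e : ∀ s : ℝ, (l * (2 * s - 1)) ^ 2 = (l * |2 * s - 1|) ^ 2 := by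
    intro s; rw [mul_pow, mul_pow, sq_abs]
  simp only [e]
  refine ⟨convex_Icc 0 1, fun s hs t ht α β hα hβ hαβ => ?_⟩
  have h1 := (convexOn_h_sqrt hC hl).2 (hmem s hs) (hmem t ht) hα hβ hαβ
  refine le_trans (monotoneOn_h_sqrt hC (hmem _ (convex_Icc 0 1 hs ht hα hβ hαβ))
    (convex_Icc 0 l (hmem s hs) (hmem t ht) hα hβ hαβ) ?_) h1
  simp only [smul_eq_mul]
  have h2 : |2 * (α * s + β * t) - 1| ≤ α * |2 * s - 1| + β * |2 * t - 1| := by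
    have : 2 * (α * s + β * t) - 1 = α * (2 * s - 1) + β * (2 * t - 1) := by
      linear_combination hαβ
    rw [this]
    refine (abs_add_le _ _).trans ?_
    rw [abs_mul, abs_mul, abs_of_nonneg hα, abs_of_nonneg hβ]
  calc _ ≤ l * (α * |2 * s - 1| + β * |2 * t - 1|) := by gcongr
    _ = _ := by ring

/-! ### The boundary radius of the steering ellipse. -/

namespace XState

variable (X : XState)

theorem add_mul_add_nonneg : 0 ≤ (X.a + X.b) * (X.c + X.d) :=
  mul_nonneg (add_nonneg X.a_nonneg X.b_nonneg) (add_nonneg X.c_nonneg X.d_nonneg)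

/-- Height of the Bloch vector of `B` after the outcome `|0⟩⟨0|` on `A`. -/
noncomputable def z1 : ℝ := (X.a - X.b) / (X.a + X.b)

/-- Height of the Bloch vector of `B` after the outcome `|1⟩⟨1|` on `A`. -/
noncomputable def z2 : ℝ := (X.c - X.d) / (X.c + X.d)

/-- Distance from the origin to the boundary of the steering ellipsoid at the relative height
`s`. -/
noncomputable def radius (s : ℝ) : ℝ :=
  √((s * X.z1 + (1 - s) * X.z2) ^ 2 + 4 * s * (1 - s) * X.l1 ^ 2)

/-- If $a+b=0$, then $a=b=0$ and the default value of the quotient is harmless. -/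
theorem z1_mul : X.z1 * (X.a + X.b) = X.a - X.b := by
  rw [z1]
  refine div_mul_cancel_of_imp fun h0 => ?_
  linarith [X.a_nonneg, X.b_nonneg]

theorem z2_mul : X.z2 * (X.c + X.d) = X.c - X.d := by
  rw [z2]
  refine div_mul_cancel_of_imp fun h0 => ?_
  linarith [X.c_nonneg, X.d_nonneg]

theorem l1_nonneg : 0 ≤ X.l1 :=
  div_nonneg (add_nonneg X.u_nonneg X.v_nonneg) (Real.sqrt_nonneg _)

theorem l1_sq_mul : X.l1 ^ 2 * ((X.a + X.b) * (X.c + X.d)) = (X.u + X.v) ^ 2 := by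
  rw [l1, div_pow, Real.sq_sqrt X.add_mul_add_nonneg]
  refine div_mul_cancel_of_imp fun h0 => ?_
  have h1 := X.u_sq_le
  have h2 := X.v_sq_le
  have h3 := mul_nonneg X.a_nonneg X.c_nonneg
  have h4 := mul_nonneg X.a_nonneg X.d_nonneg
  have h5 := mul_nonneg X.b_nonneg X.c_nonneg
  have h6 := mul_nonneg X.b_nonneg X.d_nonneg
  have h7 : X.u = 0 := by
    rw [← sq_eq_zero_iff]
    nlinarith [sq_nonneg X.u]
  have h8 : X.v = 0 := by
    rw [← sq_eq_zero_iff]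
    nlinarith [sq_nonneg X.v]
  simp [h7, h8]

/-- Positivity of the unnormalized state of $B$ for $M$ with diagonal $m,n$ and off-diagonal entry
$\sqrt{mn}$. The cross term $2mn\,uv$ is handled by $uv\le\sqrt{ab\cdot cd}$ and AM-GM. -/
theorem add_sq_mul_le {m n : ℝ} (hm : 0 ≤ m) (hn : 0 ≤ n) :
    m * n * (X.u + X.v) ^ 2 ≤ (m * X.a + n * X.c) * (m * X.b + n * X.d) := by
  have huv : (X.u * X.v) ^ 2 ≤ (X.a * X.b) * (X.c * X.d) := by
    have := mul_le_mul X.u_sq_le X.v_sq_le (sq_nonneg _) (mul_nonneg X.a_nonneg X.d_nonneg)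
    nlinarith
  have h1 : m * n * (2 * (X.u * X.v)) ≤ m ^ 2 * (X.a * X.b) + n ^ 2 * (X.c * X.d) := by
    have hab := mul_nonneg X.a_nonneg X.b_nonneg
    have hcd := mul_nonneg X.c_nonneg X.d_nonneg
    refine abs_le_of_sq_le_sq' ?_ (by positivity) |>.2
    have h2 : (m * n) ^ 2 * (X.u * X.v) ^ 2 ≤ (m * n) ^ 2 * ((X.a * X.b) * (X.c * X.d)) := by
      gcongr
    nlinarith [sq_nonneg (m ^ 2 * (X.a * X.b) - n ^ 2 * (X.c * X.d))]
  have h2 := mul_le_mul_of_nonneg_left (add_le_add X.u_sq_le X.v_sq_le) (mul_nonneg hm hn)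
  nlinarith

theorem radius_sq_mul {m n p : ℝ} (hp : p ≠ 0)
    (hp' : p = m * (X.a + X.b) + n * (X.c + X.d)) :
    ((m * (X.a + X.b) / p * X.z1 + (1 - m * (X.a + X.b) / p) * X.z2) ^ 2 +
      4 * (m * (X.a + X.b) / p) * (1 - m * (X.a + X.b) / p) * X.l1 ^ 2) =
      ((m * (X.a - X.b) + n * (X.c - X.d)) ^ 2 + 4 * (m * n) * (X.u + X.v) ^ 2) / p ^ 2 := by
  have e : 1 - m * (X.a + X.b) / p = n * (X.c + X.d) / p := by
    field_simp
    linarith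
  rw [e, ← X.z1_mul, ← X.z2_mul, ← X.l1_sq_mul]
  field_simp

theorem radius_mem_Icc {m n p : ℝ} (hm : 0 ≤ m) (hn : 0 ≤ n) (hp : p ≠ 0)
    (hp' : p = m * (X.a + X.b) + n * (X.c + X.d)) :
    X.radius (m * (X.a + X.b) / p) ∈ Set.Icc (0 : ℝ) 1 := by
  refine ⟨Real.sqrt_nonneg _, Real.sqrt_le_one.2 ?_⟩
  rw [X.radius_sq_mul hp hp', div_le_one (by positivity), hp']
  linear_combination 4 * X.add_sq_mul_le hm hn

end XState

/-! ### Entropy bounds for POVMs and the two spin measurements. -/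

namespace XState

variable (X : XState)

/-- The two sides differ by $4uv(\operatorname{Im}\beta)^2$: real coherences are the most effective.
-/
theorem normSq_coherence_le {u v : ℝ} (hu : 0 ≤ u) (hv : 0 ≤ v) (β : ℂ) :
    Complex.normSq (star β * u + β * v) ≤ Complex.normSq β * (u + v) ^ 2 := by
  simp only [Complex.normSq_apply, Complex.add_re, Complex.add_im, Complex.mul_re, Complex.mul_im,
    Complex.star_def, Complex.conj_re, Complex.conj_im, Complex.ofReal_re, Complex.ofReal_im]
  nlinarith [mul_nonneg (mul_nonneg hu hv) (sq_nonneg β.im)]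

theorem vnEntropy_condState {M : Op} (hM : M.PosSemidef) (hp : outcomeProb X.rho M ≠ 0) :
    vnEntropy (condState X.rho M) =
      h √((((M 0 0).re * (X.a - X.b) + (M 1 1).re * (X.c - X.d)) ^ 2 +
        4 * Complex.normSq (star (M 0 1) * X.u + M 0 1 * X.v)) / outcomeProb X.rho M ^ 2) := by
  obtain ⟨-, -, e0, e1, hs, -⟩ := posSemidef_entries hM
  have hpe := X.outcomeProb_eq M
  set p := outcomeProb X.rho M
  have hp2 : (p : ℂ) ≠ 0 := by exact_mod_cast hp
  set m := (M 0 0).re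
  set n := (M 1 1).re
  set β := M 0 1
  have hT : condState X.rho M = !![((p⁻¹ * (m * X.a + n * X.c) : ℝ) : ℂ),
      ((p⁻¹ : ℝ) : ℂ) * (star β * X.u + β * X.v);
      ((p⁻¹ : ℝ) : ℂ) * star (star β * X.u + β * X.v),
      ((p⁻¹ * (m * X.b + n * X.d) : ℝ) : ℂ)] := by
    rw [condState, traceA_kronecker_mul_rho, hs, e0, e1]
    ext i j
    fin_cases i <;> fin_cases j <;> 
      simp [p, β, show outcomeProb X.rho M ≠ 0 from hp] <;> ring
  rw [vnEntropy_eq, hT, Matrix.det_fin_two_of]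
  · congr 2
    have : ((p⁻¹ : ℝ) : ℂ) * (star β * X.u + β * X.v) *
        (((p⁻¹ : ℝ) : ℂ) * star (star β * X.u + β * X.v)) =
        ((p⁻¹ ^ 2 * Complex.normSq (star β * X.u + β * X.v) : ℝ) : ℂ) := by
      rw [Complex.ofReal_mul, ← Complex.mul_conj]
      push_cast
      simp only [Complex.star_def]
      ring
    rw [this, ← Complex.ofReal_mul, ← Complex.ofReal_sub, Complex.ofReal_re]
    field_simp
    rw [hpe]
    ring
  · rw [hT]
    ext i j
    fin_cases i <;> fin_cases j <;> simp
  · rw [hT, Matrix.trace_fin_two_of, ← Complex.ofReal_add, ← mul_add]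
    rw [show m * X.a + n * X.c + (m * X.b + n * X.d) = p by rw [hpe]; ring, inv_mul_cancel₀ hp]
    simp

/-- Relative height of the state of `B` after the outcome `M`. -/
noncomputable def relHeight (M : Op) : ℝ := (M 0 0).re * (X.a + X.b) / outcomeProb X.rho M

theorem outcomeProb_nonneg {M : Op} (hM : M.PosSemidef) : 0 ≤ outcomeProb X.rho M := by
  obtain ⟨h0, h1, -⟩ := posSemidef_entries hM
  rw [outcomeProb_eq]
  have := X.a_nonneg
  have := X.b_nonneg
  have := X.c_nonneg
  have := X.d_nonneg
  positivity

theorem relHeight_mem_Icc {M : Op} (hM : M.PosSemidef) : X.relHeight M ∈ Set.Icc (0 : ℝ) 1 := by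
  obtain ⟨h0, h1, -⟩ := posSemidef_entries hM
  have h2 := add_nonneg X.a_nonneg X.b_nonneg
  have h3 := mul_nonneg h1 (add_nonneg X.c_nonneg X.d_nonneg)
  refine ⟨div_nonneg (mul_nonneg h0 h2) (X.outcomeProb_nonneg hM),
    div_le_one_of_le₀ ?_ (X.outcomeProb_nonneg hM)⟩
  rw [outcomeProb_eq]
  linarith

theorem outcomeProb_mul_relHeight {M : Op} (hM : M.PosSemidef) :
    outcomeProb X.rho M * X.relHeight M = (M 0 0).re * (X.a + X.b) := by
  obtain ⟨h0, h1, -⟩ := posSemidef_entries hM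
  have h2 := mul_nonneg h0 (add_nonneg X.a_nonneg X.b_nonneg)
  have h3 := mul_nonneg h1 (add_nonneg X.c_nonneg X.d_nonneg)
  refine mul_div_cancel_of_imp' fun hp => ?_
  rw [outcomeProb_eq] at hp
  linarith

/-- At a fixed height the entropy is least on the boundary of the ellipse. The factor $p$ admits
outcomes of probability zero. -/
theorem outcomeProb_mul_le {M : Op} (hM : M.PosSemidef) :
    outcomeProb X.rho M * h (X.radius (X.relHeight M)) ≤
      outcomeProb X.rho M * vnEntropy (condState X.rho M) := by
  rcases eq_or_ne (outcomeProb X.rho M) 0 with hp | hp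
  · simp [hp]
  obtain ⟨h0, h1, e0, e1, hs, hβ⟩ := posSemidef_entries hM
  have hpe := X.outcomeProb_eq M
  have hR := X.radius_mem_Icc h0 h1 hp hpe
  refine mul_le_mul_of_nonneg_left ?_ (X.outcomeProb_nonneg hM)
  rw [X.vnEntropy_condState hM hp, relHeight]
  have hle : √((((M 0 0).re * (X.a - X.b) + (M 1 1).re * (X.c - X.d)) ^ 2 +
        4 * Complex.normSq (star (M 0 1) * X.u + M 0 1 * X.v)) / outcomeProb X.rho M ^ 2) ≤
      X.radius ((M 0 0).re * (X.a + X.b) / outcomeProb X.rho M) := by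
    refine Real.sqrt_le_sqrt ?_
    rw [X.radius_sq_mul hp hpe]
    gcongr ?_ / _
    have := (normSq_coherence_le X.u_nonneg X.v_nonneg (M 0 1)).trans
      (mul_le_mul_of_nonneg_right hβ (sq_nonneg _))
    linarith
  exact h_antitoneOn ⟨Real.sqrt_nonneg _, hle.trans hR.2⟩ hR hle

theorem outcomeProb_mul_eq {M : Op} (hM : M.PosSemidef)
    (hβ : (M 0 1).im = 0) (hβ' : (M 0 1).re ^ 2 = (M 0 0).re * (M 1 1).re) :
    outcomeProb X.rho M * vnEntropy (condState X.rho M) =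
      outcomeProb X.rho M * h (X.radius (X.relHeight M)) := by
  rcases eq_or_ne (outcomeProb X.rho M) 0 with hp | hp
  · simp [hp]
  rw [X.vnEntropy_condState hM hp, relHeight, radius,
    X.radius_sq_mul hp (X.outcomeProb_eq M), ← hβ']
  congr 5
  simp [Complex.normSq_apply, hβ]
  ring

theorem sum_outcomeProb {n : ℕ} {M : Fin n → Op} (hM : IsPOVM M) :
    ∑ i, outcomeProb X.rho (M i) = 1 := by
  have h0 := congrArg Complex.re (congrFun (congrFun hM.2 0) 0)
  have h1 := congrArg Complex.re (congrFun (congrFun hM.2 1) 1)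
  simp only [Matrix.sum_apply, Complex.re_sum, Matrix.one_apply_eq, Complex.one_re] at h0 h1
  simp only [outcomeProb_eq, Finset.sum_add_distrib, ← Finset.sum_mul, h0, h1]
  linarith [X.trace_one]

/-- The mean of $s$ does not depend on the measurement, which is what makes Jensen applicable. -/
theorem sum_outcomeProb_mul_relHeight {n : ℕ} {M : Fin n → Op} (hM : IsPOVM M) :
    ∑ i, outcomeProb X.rho (M i) * X.relHeight (M i) = X.a + X.b := by
  have h0 := congrArg Complex.re (congrFun (congrFun hM.2 0) 0)
  simp only [Matrix.sum_apply, Complex.re_sum, Matrix.one_apply_eq, Complex.one_re] at h0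
  simp only [fun i => X.outcomeProb_mul_relHeight (hM.1 i), ← Finset.sum_mul, h0, one_mul]

theorem isPOVM_pauliX : IsPOVM (spinMeasurement pauliX) := by
  refine isPOVM_spinMeasurement ?_ ?_ <;> ext i j <;> fin_cases i <;> fin_cases j <;>
    simp [pauliX]

theorem isPOVM_pauliZ : IsPOVM (spinMeasurement pauliZ) := by
  refine isPOVM_spinMeasurement ?_ ?_ <;> ext i j <;> fin_cases i <;> fin_cases j <;>
    simp [pauliZ]

theorem condEntropy_pauliX :
    condEntropy X.rho (spinMeasurement pauliX) = h (X.radius (X.a + X.b)) := by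
  have hP := isPOVM_pauliX
  have e : ∀ i, outcomeProb X.rho (spinMeasurement pauliX i) = 1 / 2 := by
    intro i
    have := X.trace_one
    fin_cases i <;> simp [outcomeProb_eq, spinMeasurement, pauliX] <;> linarith
  have e2 : ∀ i, X.relHeight (spinMeasurement pauliX i) = X.a + X.b := by
    intro i
    rw [relHeight, e]
    fin_cases i <;> simp [spinMeasurement, pauliX] <;> ring
  rw [condEntropy, Finset.sum_congr rfl fun i _ => X.outcomeProb_mul_eq (hP.1 i) ?_ ?_]
  · simp only [e, e2, Fin.sum_univ_two]
    ring
  · fin_cases i <;> simp [spinMeasurement, pauliX]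
  · fin_cases i <;> norm_num [spinMeasurement, pauliX]

theorem condEntropy_pauliZ :
    condEntropy X.rho (spinMeasurement pauliZ) =
      (X.a + X.b) * h (X.radius 1) + (X.c + X.d) * h (X.radius 0) := by
  have hP := isPOVM_pauliZ
  have e0 : outcomeProb X.rho (spinMeasurement pauliZ 0) = X.a + X.b := by
    norm_num [outcomeProb_eq, spinMeasurement, pauliZ]
  have e1 : outcomeProb X.rho (spinMeasurement pauliZ 1) = X.c + X.d := by
    norm_num [outcomeProb_eq, spinMeasurement, pauliZ]
  have s1 : X.relHeight (spinMeasurement pauliZ 1) = 0 := by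
    norm_num [relHeight, spinMeasurement, pauliZ]
  rw [condEntropy, Finset.sum_congr rfl fun i _ => X.outcomeProb_mul_eq (hP.1 i) ?_ ?_]
  · rw [Fin.sum_univ_two, e0, e1, s1]
    congr 1
    -- For $a+b=0$ the weight is $0/0=0$ instead of $1$, but the outcome has probability zero.
    rcases eq_or_ne (X.a + X.b) 0 with h0 | h0
    · simp [h0]
    · have s0 : X.relHeight (spinMeasurement pauliZ 0) = 1 := by
        rw [relHeight, e0]
        norm_num [spinMeasurement, pauliZ]
        exact h0
      rw [s0]
  · fin_cases i <;> simp [spinMeasurement, pauliZ]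
  · fin_cases i <;> norm_num [spinMeasurement, pauliZ]

theorem isOptimal_pauliX_of_convexOn
    (hc : ConvexOn ℝ (Set.Icc 0 1) fun s => h (X.radius s)) :
    IsOptimalMeasurement X.rho (spinMeasurement pauliX) := by
  refine ⟨isPOVM_pauliX, fun m N hN => ?_⟩
  rw [condEntropy_pauliX, condEntropy]
  refine le_trans ?_ (Finset.sum_le_sum fun i _ => X.outcomeProb_mul_le (hN.1 i))
  have := hc.map_sum_le (t := Finset.univ) (fun i _ => X.outcomeProb_nonneg (hN.1 i))
    (X.sum_outcomeProb hN) (fun i _ => X.relHeight_mem_Icc (hN.1 i))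
  simpa only [smul_eq_mul, X.sum_outcomeProb_mul_relHeight hN] using this

theorem isOptimal_pauliZ_of_concaveOn
    (hc : ConcaveOn ℝ (Set.Icc 0 1) fun s => h (X.radius s)) :
    IsOptimalMeasurement X.rho (spinMeasurement pauliZ) := by
  refine ⟨isPOVM_pauliZ, fun m N hN => ?_⟩
  rw [condEntropy_pauliZ, condEntropy]
  refine le_trans ?_ (Finset.sum_le_sum fun i _ => X.outcomeProb_mul_le (hN.1 i))
  have hle : ∀ i, outcomeProb X.rho (N i) * (X.relHeight (N i) * h (X.radius 1) +
      (1 - X.relHeight (N i)) * h (X.radius 0)) ≤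
      outcomeProb X.rho (N i) * h (X.radius (X.relHeight (N i))) := by
    intro i
    refine mul_le_mul_of_nonneg_left ?_ (X.outcomeProb_nonneg (hN.1 i))
    have hs := X.relHeight_mem_Icc (hN.1 i)
    have := hc.2 (Set.right_mem_Icc.2 zero_le_one) (Set.left_mem_Icc.2 zero_le_one) hs.1
      (sub_nonneg.2 hs.2) (add_sub_cancel _ _)
    simpa using this
  refine le_trans (le_of_eq ?_) (Finset.sum_le_sum fun i _ => hle i)
  have e1 := X.sum_outcomeProb hN
  have e2 := X.sum_outcomeProb_mul_relHeight hN
  have e3 : X.c + X.d = 1 - (X.a + X.b) := by linarith [X.trace_one]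
  simp only [mul_add, mul_sub, ← mul_assoc, sub_mul, Finset.sum_add_distrib,
    Finset.sum_sub_distrib, ← Finset.sum_mul, e1, e2, e3, one_mul]

end XState

/-! ### The degenerate case, and passing between height and weight. -/

namespace XState

variable (X : XState)

theorem isOptimal_pauliX_of_degenerate (hX : X.a * X.d = X.b * X.c) :
    IsOptimalMeasurement X.rho (spinMeasurement pauliX) := by
  -- If $A$ is in a basis state, every outcome of positive probability has the same weight $s=a+b$.
  by_cases hP : X.a + X.b = 0 ∨ X.c + X.d = 0
  · refine ⟨isPOVM_pauliX, fun m N hN => ?_⟩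
    rw [condEntropy_pauliX, condEntropy]
    refine le_trans (le_of_eq ?_)
      (Finset.sum_le_sum fun i _ => X.outcomeProb_mul_le (hN.1 i))
    have he : ∀ i, outcomeProb X.rho (N i) * h (X.radius (X.relHeight (N i))) =
        outcomeProb X.rho (N i) * h (X.radius (X.a + X.b)) := by
      intro i
      rcases eq_or_ne (outcomeProb X.rho (N i)) 0 with hp | hp
      · simp [hp]
      rcases hP with h0 | h0
      · rw [relHeight, h0, mul_zero, zero_div]
      · have h1 : X.a + X.b = 1 := by linarith [X.trace_one]
        rw [relHeight, outcomeProb_eq, h0, h1, mul_zero, add_zero, mul_one, div_self]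
        rwa [outcomeProb_eq, h0, h1, mul_zero, add_zero, mul_one] at hp
    rw [Finset.sum_congr rfl fun i _ => he i, ← Finset.sum_mul, X.sum_outcomeProb hN, one_mul]
  · push Not at hP
    obtain ⟨hP, hQ⟩ := hP
    have hz : X.z1 = X.z2 := by
      rw [z1, z2, div_eq_div_iff hP hQ]
      linear_combination 2 * hX
    have hR : ∀ s, X.radius s = √(X.z2 ^ 2 + X.l1 ^ 2 - (X.l1 * (2 * s - 1)) ^ 2) := by
      intro s
      rw [radius, hz]
      ring_nf
    refine X.isOptimal_pauliX_of_convexOn ?_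
    simp only [hR]
    refine convexOn_h_sqrt_abs ?_ X.l1_nonneg (by nlinarith [sq_nonneg X.z2])
    -- These $m,n$ give $s=1/2$, where the squared radius is exactly $C=z_2^2+\ell_1^2$; hence
    -- $C\le1$.
    have h1 : (1 : ℝ) = 1 / (2 * (X.a + X.b)) * (X.a + X.b) +
        1 / (2 * (X.c + X.d)) * (X.c + X.d) := by
      field_simp
      norm_num
    have hP0 := add_nonneg X.a_nonneg X.b_nonneg
    have hQ0 := add_nonneg X.c_nonneg X.d_nonneg
    have h2 := (X.radius_mem_Icc (by positivity) (by positivity) one_ne_zero h1).2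
    rw [hR, Real.sqrt_le_one] at h2
    convert h2 using 1
    field_simp
    ring

theorem pos_of_ne (hX : X.a * X.d ≠ X.b * X.c) : 0 < X.a + X.b ∧ 0 < X.c + X.d := by
  have ha := X.a_nonneg
  have hb := X.b_nonneg
  have hc := X.c_nonneg
  have hd := X.d_nonneg
  constructor
  · by_contra! h0
    have h1 : X.a = 0 := by linarith
    have h2 : X.b = 0 := by linarith
    simp [h1, h2] at hX
  · by_contra! h0
    have h1 : X.c = 0 := by linarith
    have h2 : X.d = 0 := by linarith
    simp [h1, h2] at hX

theorem z0_eq (hX : X.a * X.d ≠ X.b * X.c) : X.z0 = (X.z1 + X.z2) / 2 := by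
  obtain ⟨hP, hQ⟩ := X.pos_of_ne hX
  rw [z0, z1, z2]
  field_simp
  ring

theorem l3_eq (hX : X.a * X.d ≠ X.b * X.c) : X.l3 = |(X.z1 - X.z2) / 2| := by
  obtain ⟨hP, hQ⟩ := X.pos_of_ne hX
  have e : (X.z1 - X.z2) / 2 =
      (X.a * X.d - X.b * X.c) / ((X.a + X.b) * (X.c + X.d)) := by
    rw [z1, z2]
    field_simp
    ring
  rw [l3, e, abs_div, abs_of_pos (mul_pos hP hQ)]

theorem z1_ne_z2 (hX : X.a * X.d ≠ X.b * X.c) : X.z1 ≠ X.z2 := by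
  obtain ⟨hP, hQ⟩ := X.pos_of_ne hX
  intro he
  rw [z1, z2, div_eq_div_iff hP.ne' hQ.ne'] at he
  apply hX
  linear_combination he / 2

theorem zH_eq (hX : X.a * X.d ≠ X.b * X.c) : X.zH = min X.z1 X.z2 := by
  rw [zH, X.z0_eq hX, X.l3_eq hX]
  rcases le_total X.z1 X.z2 with hz | hz
  · rw [min_eq_left hz, abs_of_nonpos (by linarith)]
    ring
  · rw [min_eq_right hz, abs_of_nonneg (by linarith)]
    ring

theorem zG_eq (hX : X.a * X.d ≠ X.b * X.c) : X.zG = max X.z1 X.z2 := by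
  rw [zG, X.z0_eq hX, X.l3_eq hX]
  rcases le_total X.z1 X.z2 with hz | hz
  · rw [max_eq_right hz, abs_of_nonpos (by linarith)]
    ring
  · rw [max_eq_left hz, abs_of_nonneg (by linarith)]
    ring

theorem height_mem (hX : X.a * X.d ≠ X.b * X.c) {s : ℝ} (hs : s ∈ Set.Icc (0 : ℝ) 1) :
    s * X.z1 + (1 - s) * X.z2 ∈ Set.Icc X.zH X.zG := by
  rw [X.zH_eq hX, X.zG_eq hX]
  refine convex_Icc _ _ (x := X.z1) (y := X.z2) ?_ ?_ hs.1 (sub_nonneg.2 hs.2) (add_sub_cancel _ _)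
  · simp
  · simp

theorem horizontalEntropy_height (hX : X.a * X.d ≠ X.b * X.c) (s : ℝ) :
    X.horizontalEntropy (s * X.z1 + (1 - s) * X.z2) = h (X.radius s) := by
  have hz := sub_ne_zero.2 (X.z1_ne_z2 hX)
  rw [horizontalEntropy, r, radius, X.l3_eq hX, X.z0_eq hX, sq_abs]
  congr 2
  field_simp
  ring

theorem convexOn_radius (hX : X.a * X.d ≠ X.b * X.c)
    (hc : ConvexOn ℝ (Set.Icc X.zH X.zG) X.horizontalEntropy) :
    ConvexOn ℝ (Set.Icc 0 1) fun s => h (X.radius s) := by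
  refine ⟨convex_Icc 0 1, fun s hs t ht α β hα hβ hαβ => ?_⟩
  have := hc.2 (X.height_mem hX hs) (X.height_mem hX ht) hα hβ hαβ
  have e : α • (s * X.z1 + (1 - s) * X.z2) + β • (t * X.z1 + (1 - t) * X.z2) =
      (α • s + β • t) * X.z1 + (1 - (α • s + β • t)) * X.z2 := by
    simp only [smul_eq_mul]
    linear_combination hαβ * X.z2
  rw [e] at this
  simpa only [X.horizontalEntropy_height hX] using this

theorem concaveOn_radius (hX : X.a * X.d ≠ X.b * X.c)
    (hc : ConcaveOn ℝ (Set.Icc X.zH X.zG) X.horizontalEntropy) :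
    ConcaveOn ℝ (Set.Icc 0 1) fun s => h (X.radius s) := by
  refine ⟨convex_Icc 0 1, fun s hs t ht α β hα hβ hαβ => ?_⟩
  have := hc.2 (X.height_mem hX hs) (X.height_mem hX ht) hα hβ hαβ
  have e : α • (s * X.z1 + (1 - s) * X.z2) + β • (t * X.z1 + (1 - t) * X.z2) =
      (α • s + β • t) * X.z1 + (1 - (α • s + β • t)) * X.z2 := by
    simp only [smul_eq_mul]
    linear_combination hαβ * X.z2
  rw [e] at this
  simpa only [X.horizontalEntropy_height hX] using this

/-! ### Recovering the parameters from the steering ellipsoid. -/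

theorem blochVector_condState_two {M : Op} (hM : M.PosSemidef) (hp : outcomeProb X.rho M ≠ 0) :
    blochVector (condState X.rho M) 2 = X.relHeight M * X.z1 + (1 - X.relHeight M) * X.z2 := by
  obtain ⟨-, -, e0, e1, -⟩ := posSemidef_entries hM
  have e : 1 - X.relHeight M = (M 1 1).re * (X.c + X.d) / outcomeProb X.rho M := by
    rw [relHeight, eq_div_iff hp, sub_mul, div_mul_cancel₀ _ hp, outcomeProb_eq]
    ring
  have e2 : blochVector (condState X.rho M) 2 =
      ((M 0 0).re * (X.a - X.b) + (M 1 1).re * (X.c - X.d)) / outcomeProb X.rho M := by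
    rw [blochVector, condState, traceA_kronecker_mul_rho, e0, e1]
    simp [pauliZ, Matrix.trace_fin_two, ← Complex.ofReal_inv]
    field_simp
    ring
  rw [e, relHeight, e2, ← X.z1_mul, ← X.z2_mul]
  ring

theorem blochVector_condState_zero {M : Op} (hM : M.PosSemidef) :
    blochVector (condState X.rho M) 0 =
      2 * (M 0 1).re * (X.u + X.v) / outcomeProb X.rho M := by
  obtain ⟨-, -, -, -, e2, -⟩ := posSemidef_entries hM
  rw [blochVector, condState, traceA_kronecker_mul_rho, e2]
  simp [pauliX, Matrix.trace_fin_two, ← Complex.ofReal_inv]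
  ring

theorem l1_mul_sqrt (hX : X.a * X.d ≠ X.b * X.c) :
    X.l1 * √((X.a + X.b) * (X.c + X.d)) = X.u + X.v := by
  obtain ⟨hP, hQ⟩ := X.pos_of_ne hX
  exact div_mul_cancel₀ _ (by positivity)

theorem isGreatest_l1 (hX : X.a * X.d ≠ X.b * X.c) :
    IsGreatest ((fun w : Fin 3 → ℝ => w 0) '' steeringEllipsoid X.rho) X.l1 := by
  obtain ⟨hP, hQ⟩ := X.pos_of_ne hX
  have hq := Real.sq_sqrt X.add_mul_add_nonneg
  have hq0 : 0 < √((X.a + X.b) * (X.c + X.d)) := by positivity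
  have hl := X.l1_mul_sqrt hX
  set q := √((X.a + X.b) * (X.c + X.d))
  constructor
  -- The real rank-one projector with $M_{00}(a+b)=M_{11}(c+d)$, that is $s=1/2$, reaches the tip of
  -- the $x$ semi-axis.
  · set M : Op := !![((X.c + X.d : ℝ) : ℂ), (q : ℂ); (q : ℂ), ((X.a + X.b : ℝ) : ℂ)] with hMdef
    have hM1 : M.IsHermitian := by
      ext i j
      fin_cases i <;> fin_cases j <;> simp [M]
    have hM2 : M * M = M := by
      have ht := X.trace_one
      have e1 : (X.c + X.d) * (X.c + X.d) + q * q = X.c + X.d := by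
        rw [← sq q, hq]
        linear_combination (X.c + X.d) * ht
      have e2 : q * q + (X.a + X.b) * (X.a + X.b) = X.a + X.b := by
        rw [← sq q, hq]
        linear_combination (X.a + X.b) * ht
      have e3 : (X.c + X.d) * q + q * (X.a + X.b) = q := by
        linear_combination q * ht
      have e4 : q * (X.c + X.d) + (X.a + X.b) * q = q := by
        linear_combination q * ht
      rw [hMdef, Matrix.mul_fin_two]
      simp only [← Complex.ofReal_mul, ← Complex.ofReal_add, e1, e2, e3, e4]
    have hM := posSemidef_of_isHermitian_of_mul_self hM1 hM2
    have hp : outcomeProb X.rho M = 2 * q ^ 2 := by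
      rw [outcomeProb_eq, hq]
      simp [M]
      ring
    refine ⟨_, ⟨M, hM, posSemidef_one_sub hM1 hM2, by rw [hp]; positivity, rfl⟩, ?_⟩
    change blochVector (condState X.rho M) 0 = _
    rw [X.blochVector_condState_zero hM, hp, ← hl]
    simp [M]
    field_simp
  · rintro _ ⟨_, ⟨M, hM, -, hp, rfl⟩, rfl⟩
    change blochVector (condState X.rho M) 0 ≤ _
    obtain ⟨h0, h1, -, -, -, hβ⟩ := posSemidef_entries hM
    rw [X.blochVector_condState_zero hM, div_le_iff₀ hp, ← hl]
    -- AM-GM for $M_{00}(a+b)$ and $M_{11}(c+d)$, whose sum is $p$.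
    have : 2 * (M 0 1).re * q ≤ outcomeProb X.rho M := by
      refine abs_le_of_sq_le_sq' ?_ hp.le |>.2
      rw [outcomeProb_eq]
      rw [Complex.normSq_apply] at hβ
      have h2 : (M 0 1).re ^ 2 * q ^ 2 ≤ (M 0 0).re * (M 1 1).re * q ^ 2 := by
        gcongr
        nlinarith [mul_self_nonneg (M 0 1).im]
      rw [hq] at h2
      rw [mul_pow, hq]
      nlinarith [sq_nonneg ((M 0 0).re * (X.a + X.b) - (M 1 1).re * (X.c + X.d))]
    have := mul_le_mul_of_nonneg_left this X.l1_nonneg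
    linarith

theorem height_mem_of_mem {w : Fin 3 → ℝ} (hw : w ∈ steeringEllipsoid X.rho) :
    ∃ M : Op, M.PosSemidef ∧ outcomeProb X.rho M ≠ 0 ∧
      w 2 = X.relHeight M * X.z1 + (1 - X.relHeight M) * X.z2 := by
  obtain ⟨M, hM, -, hp, rfl⟩ := hw
  exact ⟨M, hM, hp.ne', X.blochVector_condState_two hM hp.ne'⟩

theorem z1_mem (hP : 0 < X.a + X.b) :
    X.z1 ∈ (fun w : Fin 3 → ℝ => w 2) '' steeringEllipsoid X.rho := by
  have hM1 : (!![1, 0; 0, 0] : Op).IsHermitian := by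
    ext i j; fin_cases i <;> fin_cases j <;> simp
  have hM2 : (!![1, 0; 0, 0] : Op) * !![1, 0; 0, 0] = !![1, 0; 0, 0] := by
    ext i j; fin_cases i <;> fin_cases j <;> simp
  have hM := posSemidef_of_isHermitian_of_mul_self hM1 hM2
  have hp : outcomeProb X.rho !![1, 0; 0, 0] = X.a + X.b := by simp [outcomeProb_eq]
  refine ⟨_, ⟨_, hM, posSemidef_one_sub hM1 hM2, by rwa [hp], rfl⟩, ?_⟩
  change blochVector (condState X.rho _) 2 = _
  rw [X.blochVector_condState_two hM (by rw [hp]; exact hP.ne'), relHeight, hp]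
  simp [hP.ne']

theorem z2_mem (hQ : 0 < X.c + X.d) :
    X.z2 ∈ (fun w : Fin 3 → ℝ => w 2) '' steeringEllipsoid X.rho := by
  have hM1 : (!![0, 0; 0, 1] : Op).IsHermitian := by
    ext i j; fin_cases i <;> fin_cases j <;> simp
  have hM2 : (!![0, 0; 0, 1] : Op) * !![0, 0; 0, 1] = !![0, 0; 0, 1] := by
    ext i j; fin_cases i <;> fin_cases j <;> simp
  have hM := posSemidef_of_isHermitian_of_mul_self hM1 hM2
  have hp : outcomeProb X.rho !![0, 0; 0, 1] = X.c + X.d := by simp [outcomeProb_eq]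
  refine ⟨_, ⟨_, hM, posSemidef_one_sub hM1 hM2, by rwa [hp], rfl⟩, ?_⟩
  change blochVector (condState X.rho _) 2 = _
  rw [X.blochVector_condState_two hM (by rw [hp]; exact hQ.ne'), relHeight, hp]
  simp

theorem heights_subset (hX : X.a * X.d ≠ X.b * X.c) :
    (fun w : Fin 3 → ℝ => w 2) '' steeringEllipsoid X.rho ⊆ Set.Icc X.zH X.zG := by
  rintro _ ⟨w, hw, rfl⟩
  obtain ⟨M, hM, -, e⟩ := X.height_mem_of_mem hw
  change w 2 ∈ _
  rw [e]
  exact X.height_mem hX (X.relHeight_mem_Icc hM)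

theorem isLeast_zH (hX : X.a * X.d ≠ X.b * X.c) :
    IsLeast ((fun w : Fin 3 → ℝ => w 2) '' steeringEllipsoid X.rho) X.zH := by
  obtain ⟨hP, hQ⟩ := X.pos_of_ne hX
  refine ⟨?_, fun z hz => (X.heights_subset hX hz).1⟩
  rw [X.zH_eq hX]
  rcases min_choice X.z1 X.z2 with e | e <;> rw [e]
  exacts [X.z1_mem hP, X.z2_mem hQ]

theorem isGreatest_zG (hX : X.a * X.d ≠ X.b * X.c) :
    IsGreatest ((fun w : Fin 3 → ℝ => w 2) '' steeringEllipsoid X.rho) X.zG := by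
  obtain ⟨hP, hQ⟩ := X.pos_of_ne hX
  refine ⟨?_, fun z hz => (X.heights_subset hX hz).2⟩
  rw [X.zG_eq hX]
  rcases max_choice X.z1 X.z2 with e | e <;> rw [e]
  exacts [X.z1_mem hP, X.z2_mem hQ]

/-- The steering ellipsoid lies in a horizontal plane exactly when `ad = bc`. -/
theorem subsingleton_heights_iff :
    ((fun w : Fin 3 → ℝ => w 2) '' steeringEllipsoid X.rho).Subsingleton ↔
      X.a * X.d = X.b * X.c := by
  constructor
  · intro hs
    by_contra hX
    obtain ⟨hP, hQ⟩ := X.pos_of_ne hX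
    exact X.z1_ne_z2 hX (hs (X.z1_mem hP) (X.z2_mem hQ))
  · rintro hX _ ⟨w, hw, rfl⟩ _ ⟨w', hw', rfl⟩
    obtain ⟨M, hM, hp, e⟩ := X.height_mem_of_mem hw
    obtain ⟨M', hM', hp', e'⟩ := X.height_mem_of_mem hw'
    change w 2 = w' 2
    rw [e, e']
    by_cases hP : X.a + X.b = 0
    · simp [relHeight, hP]
    by_cases hQ : X.c + X.d = 0
    · have h1 : ∀ {N : Op}, outcomeProb X.rho N ≠ 0 → X.relHeight N = 1 := by
        intro N hN
        rw [relHeight]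
        rw [outcomeProb_eq, hQ, mul_zero, add_zero] at hN ⊢
        exact div_self hN
      rw [h1 hp, h1 hp']
    have hz : X.z1 = X.z2 := by
      rw [z1, z2, div_eq_div_iff hP hQ]
      linear_combination 2 * hX
    rw [hz]
    ring

/-- The ellipsoid fixes $\ell_1$ as its largest $x$ coordinate and $z_H,z_G$ as its extreme heights;
these give $z_0$ and $\ell_3$, and `r` involves nothing else. -/
theorem horizontalEntropy_congr {X Y : XState}
    (hE : steeringEllipsoid Y.rho = steeringEllipsoid X.rho) (hX : X.a * X.d ≠ X.b * X.c) :
    Y.a * Y.d ≠ Y.b * Y.c ∧ Y.zH = X.zH ∧ Y.zG = X.zG ∧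
      Y.horizontalEntropy = X.horizontalEntropy := by
  have hY : Y.a * Y.d ≠ Y.b * Y.c := by
    rwa [Ne, ← subsingleton_heights_iff, hE, subsingleton_heights_iff]
  have e1 : Y.l1 = X.l1 := (hE ▸ Y.isGreatest_l1 hY).unique (X.isGreatest_l1 hX)
  have e2 : Y.zH = X.zH := (hE ▸ Y.isLeast_zH hY).unique (X.isLeast_zH hX)
  have e3 : Y.zG = X.zG := (hE ▸ Y.isGreatest_zG hY).unique (X.isGreatest_zG hX)
  have e4 : Y.z0 = X.z0 := by
    rw [zH, zH] at e2
    rw [zG, zG] at e3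
    linarith
  have e5 : Y.l3 = X.l3 := by
    rw [zG, zG] at e3
    linarith
  refine ⟨hY, e2, e3, ?_⟩
  ext z
  rw [horizontalEntropy, horizontalEntropy, r, r, e1, e4, e5]

end XState

end XDiscord

theorem proposition2 (X : XDiscord.XState) :
    (ConvexOn ℝ (Set.Icc X.zH X.zG) X.horizontalEntropy →
      XDiscord.IsHorizontalType (XDiscord.steeringEllipsoid X.rho)) ∧
    (X.a * X.d ≠ X.b * X.c →
      ConcaveOn ℝ (Set.Icc X.zH X.zG) X.horizontalEntropy →
      XDiscord.IsVerticalType (XDiscord.steeringEllipsoid X.rho)) := by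
  constructor
  · intro hc Y hE
    by_cases hX : X.a * X.d = X.b * X.c
    · refine Y.isOptimal_pauliX_of_degenerate ?_
      rwa [← XDiscord.XState.subsingleton_heights_iff, hE,
        XDiscord.XState.subsingleton_heights_iff]
    · obtain ⟨hY, e1, e2, e3⟩ := XDiscord.XState.horizontalEntropy_congr hE hX
      refine Y.isOptimal_pauliX_of_convexOn (Y.convexOn_radius hY ?_)
      rwa [e1, e2, e3]
  · intro hX hc Y hE
    obtain ⟨hY, e1, e2, e3⟩ := XDiscord.XState.horizontalEntropy_congr hE hX
    refine Y.isOptimal_pauliZ_of_concaveOn (Y.concaveOn_radius hY ?_)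
    rwa [e1, e2, e3]
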